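/- Proposition 9.3. Let $n\ge 1$, $Q\in(n,\infty)$, and let $\mathcal S'(\mathbb R^n)$ denote the tempered distributions with values in $\mathbb C$ (or, more generally, in a complex Banach space). There is a function $M\mapsto C(M)$, depending only on $n$, $Q$ (and the space of values), with the following property. Let $$u\in C^\infty([0,\infty);\mathcal S'(\mathbb R^n))\cap L^\infty_{loc}([0,\infty);L^Q(\mathbb R^n)),\qquad \partial_{x_i}u\in L^\infty_{loc}([0,\infty);L^Q(\mathbb R^n))\ (1\le i\le n),\qquad \partial_tu\in L^1_{loc}([0,\infty);L^Q(\mathbb R^n)),$$ and suppose that $\|\partial_tu(\cdot,t)\|_{L^Q(\mathbb R^n)}\le f(t)$ for almost every $t\ge0$, where $f\in L^1_{loc}([0,\infty))$. Then $u$ is given by a function $u(x,t)$ on $\mathbb R^n\times[0,\infty)$ (that is, for every $t\ge 0$ the distribution $u(t)$ is integration against $u(\cdot,t)$) which for every $T>0$ is continuous on $\mathbb R^n\times[0,T]$ and satisfies, whenever $\|\partial_{x_i}u(\cdot,t)\|_{L^Q(\mathbb R^n)}\le M$ for all $i$ and almost every $t\in[0,T]$, $$|u(x_2,t_2)-u(x_1,t_1)|\le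 C(M)\left(|x_2-x_1|^{1-\frac nQ}+\left(\int_{t_1}^{t_2}f(t)\,dt\right)^{1-\frac nQ}\right)$$ for all $x_1,x_2\in\mathbb R^n$ with $|x_1-x_2|\le1$ and all $0\le t_1\le t_2\le T$ with $\int_{t_1}^{t_2}f(t)\,dt\le1$. -/

import Mathlib

open MeasureTheory Set
open scoped SchwartzMap ENNReal ContDiff LineDeriv

/-- `u ∈ C^∞([0,∞); 𝓢')`: the map `u` is smooth on `[0,∞)` (one-sided at `0`) for the topology of
`𝓢'(E, F)`, which is that of pointwise convergence on test functions. -/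
def SmoothInTime {E F : Type*} [NormedAddCommGroup E] [NormedSpace ℝ E]
    [NormedAddCommGroup F] [NormedSpace ℂ F] (u : ℝ → 𝓢'(E, F)) : Prop :=
  ∀ φ : 𝓢(E, ℂ), ContDiffOn ℝ ∞ (fun t : ℝ => u t φ) (Ici 0)

/-- `u' = ∂ₜ u` on `[0,∞)` (one-sided at `0`), the derivative being taken in `𝓢'(E, F)`. -/
def IsTimeDeriv {E F : Type*} [NormedAddCommGroup E] [NormedSpace ℝ E]
    [NormedAddCommGroup F] [NormedSpace ℂ F] (u u' : ℝ → 𝓢'(E, F)) : Prop :=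
  ∀ φ : 𝓢(E, ℂ), ∀ t : ℝ, 0 ≤ t →
    HasDerivWithinAt (fun s : ℝ => u s φ) (u' t φ) (Ici 0) t

/-- `w ∈ L^r_loc([0,∞); L^p)` for a family `w` of tempered distributions: for almost every `t ≥ 0`
the distribution `w t` is (given by) an element `g t` of `L^p`, where `g` is a Bochner measurable
`L^p`-valued function that belongs to `L^r([0,T]; L^p)` for every `T > 0`. -/
def MemLocBochner {E F : Type*} [NormedAddCommGroup E] [InnerProductSpace ℝ E]
    [FiniteDimensional ℝ E] [MeasurableSpace E] [BorelSpace E]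
    [NormedAddCommGroup F] [NormedSpace ℂ F] [CompleteSpace F]
    (r p : ℝ≥0∞) [Fact (1 ≤ p)] (w : ℝ → 𝓢'(E, F)) : Prop :=
  ∃ g : ℝ → Lp F p (volume : Measure E),
    (∀ᵐ t : ℝ ∂(volume.restrict (Ici 0)), Lp.toTemperedDistribution (g t) = w t) ∧
    ∀ T : ℝ, 0 < T → MemLp g r (volume.restrict (Icc 0 T))

/-- The tempered distribution `w` is (given by) an element of `L^p` of norm at most `c`, that is,
`w ∈ L^p` and `‖w‖_{L^p} ≤ c`. -/
def LpNormLE {E F : Type*} [NormedAddCommGroup E] [InnerProductSpace ℝ E]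
    [FiniteDimensional ℝ E] [MeasurableSpace E] [BorelSpace E]
    [NormedAddCommGroup F] [NormedSpace ℂ F] [CompleteSpace F]
    (p : ℝ≥0∞) [Fact (1 ≤ p)] (w : 𝓢'(E, F)) (c : ℝ) : Prop :=
  ∃ h : Lp F p (volume : Measure E), Lp.toTemperedDistribution h = w ∧ ‖h‖ ≤ c

/-- The tempered distribution `w` is given by integration against the function `v`. -/
def RepresentedBy {E F : Type*} [NormedAddCommGroup E] [InnerProductSpace ℝ E]
    [FiniteDimensional ℝ E] [MeasurableSpace E] [BorelSpace E]
    [NormedAddCommGroup F] [NormedSpace ℂ F] (w : 𝓢'(E, F)) (v : E → F) : Prop :=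
  ∀ φ : 𝓢(E, ℂ), Integrable (fun x => φ x • v x) ∧ w φ = ∫ x, φ x • v x

/-! This is Morrey's argument, run on averages of `u`. Let `ν = n / Q < 1` and let `A_r(x,t)` be `u
t` tested against a smooth probability density concentrated at scale `r` around `x`. By Hölder's
inequality, testing a distribution of `L^Q` norm at most `c` in this way gives `O(c r^(-ν))`.

When the centre or the radius moves, the density changes by the divergence of a rescaled flux
(`hasDerivAt_rescale`). Integrating by parts puts the derivative on `u`, so `∂A_r/∂r` is `O(M
r^(-ν))` and a displacement `d` of the centre costs `O(M d r^(-ν))`. Since `ν < 1`, the former is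
integrable at `r = 0`: `A_r` converges to a limit `v`, with error `O(M r^(1-ν))`. In time, the bound
on `∂ₜu` gives `|A_r(x,t₂) - A_r(x,t₁)| ≤ K r^(-ν) ∫ f`. Taking `r` equal to `|x₂ - x₁|`,
respectively to `∫ f`, balances the two kinds of error and yields the exponent `1 - ν`.

The hypotheses hold only at almost every time, but `t ↦ u t φ` is continuous for each fixed `φ`, so
bounds on averages hold at every time. At almost every time `v` agrees almost everywhere with the
`L^Q` representative of `u t`, by Lebesgue differentiation; continuity in time extends the
representation to all `t`. -/

/-! ### Hölder bounds for distributions in `L^p`. -/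

section Pairing

variable {E F : Type*} [NormedAddCommGroup E] [InnerProductSpace ℝ E]
    [FiniteDimensional ℝ E] [MeasurableSpace E] [BorelSpace E]
    [NormedAddCommGroup F] [NormedSpace ℂ F] [CompleteSpace F]

/-- Hölder's inequality on a ball for an `L^p` function. -/
lemma setIntegral_norm_le_of_memLp {F : Type*} [NormedAddCommGroup F] {p : ℝ≥0∞} (hp : 1 ≤ p) (h : Lp F p (volume : Measure E))
    (x : E) (ρ : ℝ) :
    ∫ y in Metric.closedBall x ρ, ‖h y‖
      ≤ ‖h‖ * (volume.real (Metric.closedBall x ρ)) ^ (1 - 1 / p.toReal) := by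
  have hm : AEStronglyMeasurable h (volume.restrict (Metric.closedBall x ρ)) :=
    (Lp.aestronglyMeasurable h).restrict
  have hle := eLpNorm_le_eLpNorm_mul_rpow_measure_univ hp hm
  have hvol : volume (Metric.closedBall x ρ) ≠ (⊤ : ℝ≥0∞) := measure_closedBall_lt_top.ne
  have hexp : 0 ≤ 1 / (1 : ℝ≥0∞).toReal - 1 / p.toReal := by
    rcases eq_or_ne p (⊤ : ℝ≥0∞) with rfl | hp'
    · simp
    · have : 1 ≤ p.toReal := by
        simpa using (ENNReal.toReal_le_toReal (by simp) hp').2 hp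
      have : 1 / p.toReal ≤ 1 := by
        rw [div_le_one (by linarith)]; exact this
      simpa using this
  rw [integral_norm_eq_lintegral_enorm hm, ← eLpNorm_one_eq_lintegral_enorm]
  have hle2 : eLpNorm h 1 (volume.restrict (Metric.closedBall x ρ)) ≤
      eLpNorm h p volume *
        volume (Metric.closedBall x ρ) ^ (1 / (1 : ℝ≥0∞).toReal - 1 / p.toReal) := by
    refine hle.trans ?_
    rw [Measure.restrict_apply_univ]
    gcongr
    exact Measure.restrict_le_self
  have hfin : eLpNorm h p volume *
      volume (Metric.closedBall x ρ) ^ (1 / (1 : ℝ≥0∞).toReal - 1 / p.toReal) ≠ (⊤ : ℝ≥0∞) :=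
    ENNReal.mul_ne_top (Lp.eLpNorm_ne_top h) (ENNReal.rpow_ne_top_of_nonneg hexp hvol)
  have := ENNReal.toReal_mono hfin hle2
  rw [ENNReal.toReal_mul, ← ENNReal.toReal_rpow] at this
  simpa [Lp.norm_def, Measure.real] using this

/-- A distribution in `L^p` tested against a bounded function supported in a ball. -/
lemma LpNormLE.norm_apply_le {p : ℝ≥0∞} [hp : Fact (1 ≤ p)] {w : 𝓢'(E, F)} {c : ℝ}
    (hw : LpNormLE p w c) {φ : 𝓢(E, ℂ)} {B : ℝ} (hB : 0 ≤ B) {x : E} {ρ : ℝ}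
    (hφ : ∀ y, ‖φ y‖ ≤ B) (hsupp : ∀ y, y ∉ Metric.closedBall x ρ → φ y = 0) :
    ‖w φ‖ ≤ c * (B * (volume.real (Metric.closedBall x ρ)) ^ (1 - 1 / p.toReal)) := by
  obtain ⟨h, rfl, hc⟩ := hw
  rw [Lp.toTemperedDistribution_apply,
    ← setIntegral_eq_integral_of_forall_compl_eq_zero (s := Metric.closedBall x ρ)
      (fun y hy => by rw [hsupp y hy, zero_smul])]
  have hint : IntegrableOn h (Metric.closedBall x ρ) :=
    ((Lp.memLp h).locallyIntegrable hp.out).integrableOn_isCompact (isCompact_closedBall _ _)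
  calc ‖∫ y in Metric.closedBall x ρ, φ y • h y‖
      ≤ ∫ y in Metric.closedBall x ρ, B * ‖h y‖ := by
        refine norm_integral_le_of_norm_le (hint.norm.const_mul B) (.of_forall fun y => ?_)
        rw [norm_smul]
        gcongr
        exact hφ y
    _ = B * ∫ y in Metric.closedBall x ρ, ‖h y‖ := integral_const_mul _ _
    _ ≤ B * (c * (volume.real (Metric.closedBall x ρ)) ^ (1 - 1 / p.toReal)) := by
        gcongr
        refine (setIntegral_norm_le_of_memLp hp.out h x ρ).trans ?_
        gcongr
    _ = _ := by ring

end Pairing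

/-! ### Rescaled test functions and their scaling law. -/

section Rescale

variable {n : ℕ}

/-- The rescaled, reflected and translated function `y ↦ r⁻ⁿ ξ((x - y) / r)`. -/
noncomputable def rescale (ξ : EuclideanSpace ℝ (Fin n) → ℝ) (r : ℝ)
    (x y : EuclideanSpace ℝ (Fin n)) : ℝ :=
  (r ^ n)⁻¹ * ξ (r⁻¹ • (x - y))

variable {ξ : EuclideanSpace ℝ (Fin n) → ℝ}

lemma rescale_eq_zero {R : ℝ} (hξ : ∀ z, R < ‖z‖ → ξ z = 0) {r : ℝ} (hr : 0 < r)
    {x y : EuclideanSpace ℝ (Fin n)} (hy : y ∉ Metric.closedBall x (R * r)) :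
    rescale ξ r x y = 0 := by
  rw [rescale, hξ, mul_zero]
  rw [Metric.mem_closedBall, dist_comm, dist_eq_norm, not_le] at hy
  rw [norm_smul, norm_inv, Real.norm_of_nonneg hr.le, ← div_eq_inv_mul, lt_div_iff₀ hr]
  exact hy

lemma contDiff_rescale (hξ : ContDiff ℝ ∞ ξ) (r : ℝ) (x : EuclideanSpace ℝ (Fin n)) :
    ContDiff ℝ ∞ (rescale ξ r x) := by
  unfold rescale
  fun_prop

lemma hasCompactSupport_rescale {R : ℝ} (hξ : ∀ z, R < ‖z‖ → ξ z = 0) {r : ℝ} (hr : 0 < r)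
    (x : EuclideanSpace ℝ (Fin n)) : HasCompactSupport (rescale ξ r x) :=
  HasCompactSupport.intro (isCompact_closedBall x (R * r)) fun _ hy => rescale_eq_zero hξ hr hy

/-- The function `rescale ξ r x` as a complex-valued Schwartz function. -/
noncomputable def rescaleSchwartz (hξ : ContDiff ℝ ∞ ξ) {R : ℝ}
    (hξR : ∀ z, R < ‖z‖ → ξ z = 0) {r : ℝ} (hr : 0 < r) (x : EuclideanSpace ℝ (Fin n)) :
    𝓢(EuclideanSpace ℝ (Fin n), ℂ) :=
  HasCompactSupport.toSchwartzMap (f := fun y => (rescale ξ r x y : ℂ))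
    ((hasCompactSupport_rescale hξR hr x).comp_left Complex.ofReal_zero)
    (Complex.ofRealCLM.contDiff.comp (contDiff_rescale hξ r x))

@[simp]
lemma rescaleSchwartz_apply (hξ : ContDiff ℝ ∞ ξ) {R : ℝ} (hξR : ∀ z, R < ‖z‖ → ξ z = 0)
    {r : ℝ} (hr : 0 < r) (x y : EuclideanSpace ℝ (Fin n)) :
    rescaleSchwartz hξ hξR hr x y = (rescale ξ r x y : ℂ) := rfl

/-- Testing an `L^Q` distribution against a rescaled function: the scaling `r ^ (-n / Q)`. -/
lemma LpNormLE.norm_rescaleSchwartz_le {F : Type*} [NormedAddCommGroup F] [NormedSpace ℂ F]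
    [CompleteSpace F] {Q : ℝ} (hQ : 0 < Q) [Fact (1 ≤ ENNReal.ofReal Q)]
    {w : 𝓢'(EuclideanSpace ℝ (Fin n), F)} {c : ℝ} (hw : LpNormLE (ENNReal.ofReal Q) w c)
    (hξ : ContDiff ℝ ∞ ξ) (hξR : ∀ z, 2 < ‖z‖ → ξ z = 0) {B : ℝ} (hB : ∀ z, |ξ z| ≤ B)
    {r : ℝ} (hr : 0 < r) (x : EuclideanSpace ℝ (Fin n)) :
    ‖w (rescaleSchwartz hξ hξR hr x)‖ ≤
      (volume.real (Metric.closedBall (0 : EuclideanSpace ℝ (Fin n)) 2)) ^ (1 - 1 / Q)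
        * B * c * r ^ (-((n : ℝ) / Q)) := by
  have hB0 : 0 ≤ B := (abs_nonneg _).trans (hB 0)
  have key := hw.norm_apply_le (φ := rescaleSchwartz hξ hξR hr x) (B := (r ^ n)⁻¹ * B)
    (by positivity) (x := x) (ρ := 2 * r)
    (fun y => by
      rw [rescaleSchwartz_apply, Complex.norm_real, rescale, norm_mul, norm_inv, norm_pow,
        Real.norm_of_nonneg hr.le]
      gcongr
      exact hB _)
    (fun y hy => by rw [rescaleSchwartz_apply, rescale_eq_zero hξR hr hy, Complex.ofReal_zero])
  refine key.trans_eq ?_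
  rw [ENNReal.toReal_ofReal hQ.le, Measure.addHaar_real_closedBall _ _ (by positivity),
    Measure.addHaar_real_closedBall _ (0 : EuclideanSpace ℝ (Fin n)) (by positivity),
    finrank_euclideanSpace_fin, mul_pow,
    mul_right_comm (2 ^ n) (r ^ n), Real.mul_rpow (by positivity) (by positivity)]
  -- The normalisation `r⁻ⁿ` meets the Hölder factor, a power `1 - 1/Q` of a volume proportional to
  -- `rⁿ`.
  have : (r ^ n)⁻¹ * (r ^ n) ^ (1 - 1 / Q) = r ^ (-((n : ℝ) / Q)) := by
    rw [← Real.rpow_natCast, ← Real.rpow_neg hr.le, ← Real.rpow_mul hr.le, ← Real.rpow_add hr]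
    congr 1
    ring
  rw [← this]
  ring

end Rescale

/-! ### Moving the centre and the radius: the transport equation. -/

section Transport

variable {n : ℕ} {ξ : EuclideanSpace ℝ (Fin n) → ℝ}

lemma fderiv_rescale (hξ : ContDiff ℝ ∞ ξ) (r : ℝ) (x y v : EuclideanSpace ℝ (Fin n)) :
    fderiv ℝ (rescale ξ r x) y v
      = -((r ^ n)⁻¹ * r⁻¹ * fderiv ℝ ξ (r⁻¹ • (x - y)) v) := by
  have h1 : HasFDerivAt ξ (fderiv ℝ ξ (r⁻¹ • (x - y))) (r⁻¹ • (x - y)) :=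
    (hξ.differentiable (by simp) _).hasFDerivAt
  have h2 : HasFDerivAt (fun y => r⁻¹ • (x - y))
      (r⁻¹ • -ContinuousLinearMap.id ℝ (EuclideanSpace ℝ (Fin n))) y :=
    ((hasFDerivAt_id y).const_sub x).fun_const_smul _
  have h3 : HasFDerivAt (rescale ξ r x) _ y := (h1.comp y h2).const_mul (r ^ n)⁻¹
  rw [h3.fderiv]
  simp
  ring

lemma fderiv_eq_zero_of_norm_gt {R : ℝ} (hξR : ∀ z, R < ‖z‖ → ξ z = 0)
    {z : EuclideanSpace ℝ (Fin n)} (hz : R < ‖z‖) : fderiv ℝ ξ z = 0 := by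
  have : ξ =ᶠ[nhds z] fun _ => 0 := by
    filter_upwards [(isOpen_lt continuous_const continuous_norm).mem_nhds hz] with w hw
    exact hξR w hw
  rw [this.fderiv_eq]
  simp

lemma exists_norm_le_of_norm_gt {G : Type*} [NormedAddCommGroup G]
    {f : EuclideanSpace ℝ (Fin n) → G} (hf : Continuous f) {R : ℝ}
    (hfR : ∀ z, R < ‖z‖ → f z = 0) : ∃ B, 0 ≤ B ∧ ∀ z, ‖f z‖ ≤ B := by
  have hc : HasCompactSupport f :=
    HasCompactSupport.intro (isCompact_closedBall 0 R) fun z hz => hfR z (by simpa using hz)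
  obtain ⟨B, hB⟩ := hf.bounded_above_of_compact_support hc
  exact ⟨B, (norm_nonneg _).trans (hB 0), hB⟩

/-- The `i`-th component of the field transporting `rescale ξ` when the centre moves with
velocity `e` and the radius with velocity `q`. -/
def flux (ξ : EuclideanSpace ℝ (Fin n) → ℝ) (e : EuclideanSpace ℝ (Fin n)) (q : ℝ) (i : Fin n)
    (z : EuclideanSpace ℝ (Fin n)) : ℝ :=
  ξ z * (q * z i - e i)

lemma contDiff_flux (hξ : ContDiff ℝ ∞ ξ) (e : EuclideanSpace ℝ (Fin n)) (q : ℝ) (i : Fin n) :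
    ContDiff ℝ ∞ (flux ξ e q i) := by
  unfold flux
  fun_prop

lemma flux_eq_zero {R : ℝ} (hξR : ∀ z, R < ‖z‖ → ξ z = 0) (e : EuclideanSpace ℝ (Fin n)) (q : ℝ)
    (i : Fin n) (z : EuclideanSpace ℝ (Fin n)) (hz : R < ‖z‖) : flux ξ e q i z = 0 := by
  rw [flux, hξR z hz, zero_mul]

lemma abs_flux_le (hξR : ∀ z, 2 < ‖z‖ → ξ z = 0) {B : ℝ} (hB : ∀ z, ‖ξ z‖ ≤ B)
    (e : EuclideanSpace ℝ (Fin n)) (q : ℝ) (i : Fin n) (z : EuclideanSpace ℝ (Fin n)) :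
    |flux ξ e q i z| ≤ B * (2 * |q| + ‖e‖) := by
  have hB0 : 0 ≤ B := (norm_nonneg _).trans (hB z)
  by_cases hz : 2 < ‖z‖
  · rw [flux_eq_zero hξR _ _ _ _ hz, abs_zero]
    positivity
  rw [flux, abs_mul]
  have h1 : |z i| ≤ 2 := (PiLp.norm_apply_le z i).trans (not_lt.1 hz)
  have h2 : |e i| ≤ ‖e‖ := PiLp.norm_apply_le e i
  gcongr
  · exact hB z
  · calc |q * z i - e i| ≤ |q * z i| + |e i| := abs_sub _ _
      _ = |q| * |z i| + |e i| := by rw [abs_mul]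
      _ ≤ |q| * 2 + ‖e‖ := by gcongr
      _ = _ := by ring

/-- The term `n * q * ξ z`, the divergence of `q z` times `ξ`, is what matches the derivative of the
normalising factor `r⁻ⁿ`. -/
lemma sum_fderiv_flux (hξ : ContDiff ℝ ∞ ξ) (e : EuclideanSpace ℝ (Fin n)) (q : ℝ)
    (z : EuclideanSpace ℝ (Fin n)) :
    ∑ i, fderiv ℝ (flux ξ e q i) z (EuclideanSpace.single i 1)
      = fderiv ℝ ξ z (q • z - e) + n * q * ξ z := by
  have h1 : HasFDerivAt ξ (fderiv ℝ ξ z) z := (hξ.differentiable (by simp) _).hasFDerivAt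
  have h2 : ∀ i, fderiv ℝ (flux ξ e q i) z (EuclideanSpace.single i 1)
      = (q * z i - e i) * fderiv ℝ ξ z (EuclideanSpace.single i 1) + q * ξ z := by
    intro i
    have h3 : HasFDerivAt (fun z : EuclideanSpace ℝ (Fin n) => q * z i - e i)
        (q • EuclideanSpace.proj (𝕜 := ℝ) i) z :=
      ((EuclideanSpace.proj (𝕜 := ℝ) (ι := Fin n) i).hasFDerivAt.const_mul q).sub_const _
    have h4 : HasFDerivAt (flux ξ e q i) _ z := h1.mul h3
    rw [h4.fderiv]
    simp
    ring
  have h5 : q • z - e = ∑ i, (q * z i - e i) • EuclideanSpace.single i (1 : ℝ) := by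
    ext j
    simp [Finset.sum_apply, Pi.single_apply]
  rw [Finset.sum_congr rfl fun i _ => h2 i, h5, map_sum, Finset.sum_add_distrib]
  simp
  ring

/-- The transport equation satisfied by a moving rescaled function. -/
lemma hasDerivAt_rescale (hξ : ContDiff ℝ ∞ ξ) (x₀ e y : EuclideanSpace ℝ (Fin n)) (r₀ q s : ℝ)
    (hr : r₀ + s * q ≠ 0) :
    HasDerivAt (fun s => rescale ξ (r₀ + s * q) (x₀ + s • e) y)
      (∑ i, fderiv ℝ (rescale (flux ξ e q i) (r₀ + s * q) (x₀ + s • e)) y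
        (EuclideanSpace.single i 1)) s := by
  set r := r₀ + s * q with hrdef
  set ζ := r⁻¹ • (x₀ + s • e - y) with hζ
  have h1 : HasFDerivAt ξ (fderiv ℝ ξ ζ) ζ := (hξ.differentiable (by simp) _).hasFDerivAt
  have hd : HasDerivAt (fun s : ℝ => r₀ + s * q) q s := by
    simpa using ((hasDerivAt_id s).mul_const q).const_add r₀
  have hx : HasDerivAt (fun s : ℝ => x₀ + s • e - y) e s := by
    simpa using (((hasDerivAt_id s).smul_const e).const_add x₀).sub_const y
  have hz : HasDerivAt (fun s : ℝ => (r₀ + s * q)⁻¹ • (x₀ + s • e - y)) _ s :=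
    (hd.fun_inv hr).smul hx
  have h2 : HasDerivAt (fun s => rescale ξ (r₀ + s * q) (x₀ + s • e) y) _ s :=
    ((hd.fun_pow n).fun_inv (pow_ne_zero n hr)).mul (h1.comp_hasDerivAt s hz)
  convert h2 using 1
  simp only [fderiv_rescale (contDiff_flux hξ e q _), ← hrdef, ← hζ]
  rw [Finset.sum_neg_distrib, ← Finset.mul_sum, sum_fderiv_flux hξ]
  -- The rescaled variable `ζ` moves with velocity `-(qζ - e)/r`, which is the field in `flux` up to
  -- the factor `-1/r`.
  have hζ' : r⁻¹ • e + (-q / r ^ 2) • (x₀ + s • e - y) = -(r⁻¹ • (q • ζ - e)) := by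
    rw [hζ]
    generalize x₀ + s • e - y = w
    match_scalars <;> field_simp
  -- The truncated exponent `n - 1` is harmless at `n = 0`, where the factor `n` vanishes.
  have hpow : (n : ℝ) * r ^ (n - 1) * r = n * r ^ n := by
    cases n with
    | zero => simp
    | succ m => rw [Nat.add_sub_cancel, pow_succ]; ring
  have hn : (n : ℝ) * r ^ (n - 1) * q / (r ^ n) ^ 2 = n * q * (r ^ n)⁻¹ * r⁻¹ := by
    field_simp
    linear_combination q * hpow
  rw [hζ', map_neg, map_smul, smul_eq_mul, neg_div, hn]
  ring

/-- Differentiation under the integral sign for averages against a moving rescaled function. -/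
lemma hasDerivAt_integral_rescale {F : Type*} [NormedAddCommGroup F] [NormedSpace ℝ F]
    (hξ : ContDiff ℝ ∞ ξ) (hξR : ∀ z, 2 < ‖z‖ → ξ z = 0)
    {g : EuclideanSpace ℝ (Fin n) → F} (hg : LocallyIntegrable g)
    (x₀ e : EuclideanSpace ℝ (Fin n)) (r₀ q s₀ : ℝ) (hr : 0 < r₀ + s₀ * q) :
    HasDerivAt (fun s => ∫ y, rescale ξ (r₀ + s * q) (x₀ + s • e) y • g y)
      (∫ y, (∑ i, fderiv ℝ (rescale (flux ξ e q i) (r₀ + s₀ * q) (x₀ + s₀ • e)) y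
        (EuclideanSpace.single i 1)) • g y) s₀ := by
  have hgm : AEStronglyMeasurable g := hg.aestronglyMeasurable
  set r := r₀ + s₀ * q with hrdef
  have hB : ∀ i, ∃ B, 0 ≤ B ∧
      ∀ z, ‖fderiv ℝ (flux ξ e q i) z (EuclideanSpace.single i 1)‖ ≤ B := fun i =>
    exists_norm_le_of_norm_gt (R := 2)
      (((contDiff_flux hξ e q i).continuous_fderiv (by simp)).clm_apply continuous_const)
      fun z hz => by rw [fderiv_eq_zero_of_norm_gt (flux_eq_zero hξR e q i) hz]; rfl
  choose B hB0 hB using hB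
  have hcont : Continuous fun s : ℝ => r₀ + s * q := by fun_prop
  have hxcont : Continuous fun s : ℝ => ‖x₀ + s • e - (x₀ + s₀ • e)‖ := by fun_prop
  -- For these `s` the radius stays below `2r` and the centre moves by less than `1`, so all
  -- supports lie in one ball of radius `2 * (2r) + 1`; the lower bound `r / 2` controls the
  -- negative powers of the radius.
  have hs : {s : ℝ | r / 2 < r₀ + s * q ∧ r₀ + s * q < 2 * r ∧
      ‖x₀ + s • e - (x₀ + s₀ • e)‖ < 1} ∈ nhds s₀ := by
    refine Filter.inter_mem ?_ (Filter.inter_mem ?_ ?_)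
    · exact (isOpen_lt continuous_const hcont).mem_nhds (by simp only [mem_ofPred_eq]; linarith)
    · exact (isOpen_lt hcont continuous_const).mem_nhds (by simp only [mem_ofPred_eq]; linarith)
    · exact (isOpen_lt hxcont continuous_const).mem_nhds (by simp)
  have hmeas : ∀ s, AEStronglyMeasurable
      (fun y => rescale ξ (r₀ + s * q) (x₀ + s • e) y • g y) := fun s =>
    (contDiff_rescale hξ _ _).continuous.aestronglyMeasurable.smul hgm
  let K := Metric.closedBall (x₀ + s₀ • e) (4 * r + 1)
  have hgK : IntegrableOn g K := hg.integrableOn_isCompact (isCompact_closedBall _ _)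
  refine (hasDerivAt_integral_of_dominated_loc_of_deriv_le (μ := volume)
    (F := fun s y => rescale ξ (r₀ + s * q) (x₀ + s • e) y • g y)
    (F' := fun s y => (∑ i, fderiv ℝ (rescale (flux ξ e q i) (r₀ + s * q) (x₀ + s • e)) y
        (EuclideanSpace.single i 1)) • g y)
    (bound := K.indicator fun y => (∑ i, ((r / 2) ^ n)⁻¹ * (r / 2)⁻¹ * B i) * ‖g y‖)
    hs (.of_forall hmeas) ?_ ?_ (.of_forall ?_) ?_ (.of_forall ?_)).2
  · have hloc := hg.integrable_smul_left_of_hasCompactSupport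
      (contDiff_rescale hξ r (x₀ + s₀ • e)).continuous (hasCompactSupport_rescale hξR hr _)
    exact hloc
  · refine AEStronglyMeasurable.smul (Continuous.aestronglyMeasurable ?_) hgm
    refine continuous_finsetSum _ fun i _ => ?_
    exact ((contDiff_rescale (contDiff_flux hξ e q i) _ _).continuous_fderiv
      (by simp)).clm_apply continuous_const
  · rintro y s ⟨h1, h2, h3⟩
    have hrs : 0 < r₀ + s * q := by linarith
    by_cases hy : y ∈ K
    · rw [indicator_of_mem hy, norm_smul]
      gcongr
      refine (norm_sum_le _ _).trans (Finset.sum_le_sum fun i _ => ?_)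
      rw [fderiv_rescale (contDiff_flux hξ e q i), norm_neg, norm_mul, norm_mul, norm_inv,
        norm_inv, norm_pow, Real.norm_of_nonneg hrs.le]
      have := hB i ((r₀ + s * q)⁻¹ • (x₀ + s • e - y))
      gcongr
    · rw [indicator_of_notMem hy, Finset.sum_eq_zero, zero_smul, norm_zero]
      intro i _
      rw [fderiv_rescale (contDiff_flux hξ e q i), fderiv_eq_zero_of_norm_gt
        (flux_eq_zero hξR e q i), zero_apply, mul_zero, neg_zero]
      rw [norm_smul, norm_inv, Real.norm_of_nonneg hrs.le, ← div_eq_inv_mul, lt_div_iff₀ hrs]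
      have h4 : 4 * r + 1 < ‖x₀ + s₀ • e - y‖ := by
        rw [Metric.mem_closedBall, dist_comm, dist_eq_norm, not_le] at hy
        exact hy
      have h5 : ‖x₀ + s₀ • e - y‖ ≤
          ‖x₀ + s • e - y‖ + ‖x₀ + s • e - (x₀ + s₀ • e)‖ := by
        have := norm_sub_le (x₀ + s • e - y) (x₀ + s • e - (x₀ + s₀ • e))
        rwa [show x₀ + s • e - y - (x₀ + s • e - (x₀ + s₀ • e)) = x₀ + s₀ • e - y by abel] at this
      linarith
  · exact (integrable_indicator_iff measurableSet_closedBall).2 (hgK.norm.const_mul _)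
  · rintro y s ⟨h1, h2, h3⟩
    have hrs : 0 < r₀ + s * q := by linarith
    exact (hasDerivAt_rescale hξ x₀ e y r₀ q s hrs.ne').smul_const (g y)

end Transport

/-! ### Morrey estimates for averages. -/

section Morrey

variable {n : ℕ} {ξ : EuclideanSpace ℝ (Fin n) → ℝ}
  {F : Type*} [NormedAddCommGroup F] [NormedSpace ℂ F] [CompleteSpace F]

lemma lineDerivOp_rescaleSchwartz_apply (hξ : ContDiff ℝ ∞ ξ) {R : ℝ}
    (hξR : ∀ z, R < ‖z‖ → ξ z = 0) {r : ℝ} (hr : 0 < r) (x y v : EuclideanSpace ℝ (Fin n)) :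
    (∂_{v} (rescaleSchwartz hξ hξR hr x)) y = (fderiv ℝ (rescale ξ r x) y v : ℂ) := by
  rw [SchwartzMap.lineDerivOp_apply_eq_fderiv]
  have h1 : HasFDerivAt (rescale ξ r x) (fderiv ℝ (rescale ξ r x) y) y :=
    ((contDiff_rescale hξ r x).differentiable (by simp) y).hasFDerivAt
  have h2 : HasFDerivAt (rescaleSchwartz hξ hξR hr x) _ y :=
    Complex.ofRealCLM.hasFDerivAt.comp y h1
  rw [h2.fderiv]
  simp

lemma toTemperedDistribution_rescaleSchwartz {p : ℝ≥0∞} [Fact (1 ≤ p)]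
    (g : Lp F p (volume : Measure (EuclideanSpace ℝ (Fin n)))) (hξ : ContDiff ℝ ∞ ξ) {R : ℝ}
    (hξR : ∀ z, R < ‖z‖ → ξ z = 0) {r : ℝ} (hr : 0 < r) (x : EuclideanSpace ℝ (Fin n)) :
    Lp.toTemperedDistribution g (rescaleSchwartz hξ hξR hr x) = ∫ y, rescale ξ r x y • g y := by
  simp only [Lp.toTemperedDistribution_apply, rescaleSchwartz_apply, Complex.coe_smul]

variable {Q : ℝ} [Fact (1 ≤ ENNReal.ofReal Q)]
  {g : Lp F (ENNReal.ofReal Q) (volume : Measure (EuclideanSpace ℝ (Fin n)))} {M B : ℝ}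

/-- Integration by parts turns the divergence into the weak derivatives of `g` tested against the
rescaled flux components, each of which obeys the scaling law with sup bound `B * (2 * |q| + ‖e‖)`.
-/
lemma norm_integral_sum_fderiv_flux_le (hQ : 0 < Q)
    (hM : ∀ i : Fin n, LpNormLE (ENNReal.ofReal Q)
      (∂_{EuclideanSpace.single i (1 : ℝ)} (Lp.toTemperedDistribution g)) M)
    (hξ : ContDiff ℝ ∞ ξ) (hξR : ∀ z, 2 < ‖z‖ → ξ z = 0) (hB : ∀ z, ‖ξ z‖ ≤ B)
    (e x : EuclideanSpace ℝ (Fin n)) (q : ℝ) {r : ℝ} (hr : 0 < r) :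
    ‖∫ y, (∑ i, fderiv ℝ (rescale (flux ξ e q i) r x) y (EuclideanSpace.single i 1)) • g y‖ ≤
      n * (volume.real (Metric.closedBall (0 : EuclideanSpace ℝ (Fin n)) 2)) ^ (1 - 1 / Q) * B * M
        * (2 * |q| + ‖e‖) * r ^ (-((n : ℝ) / Q)) := by
  let S : Fin n → 𝓢(EuclideanSpace ℝ (Fin n), ℂ) := fun i =>
    rescaleSchwartz (contDiff_flux hξ e q i) (flux_eq_zero hξR e q i) hr x
  have h1 : ∫ y, (∑ i, fderiv ℝ (rescale (flux ξ e q i) r x) y (EuclideanSpace.single i 1)) • g y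
      = -∑ i, (∂_{EuclideanSpace.single i (1 : ℝ)} (Lp.toTemperedDistribution g) :
        𝓢'(EuclideanSpace ℝ (Fin n), F)) (S i) := by
    simp only [TemperedDistribution.lineDerivOp_apply_apply, map_neg, Finset.sum_neg_distrib,
      neg_neg]
    rw [← map_sum, Lp.toTemperedDistribution_apply]
    refine integral_congr_ae (.of_forall fun y => ?_)
    simp only [sum_apply, S, lineDerivOp_rescaleSchwartz_apply]
    rw [← Complex.ofReal_sum, Complex.coe_smul]
  rw [h1, norm_neg]
  refine (norm_sum_le _ _).trans ((Finset.sum_le_sum fun i _ =>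
    (hM i).norm_rescaleSchwartz_le hQ (contDiff_flux hξ e q i) (flux_eq_zero hξR e q i)
      (abs_flux_le hξR hB e q i) hr x).trans_eq ?_)
  rw [Finset.sum_const, Finset.card_univ, Fintype.card_fin, nsmul_eq_mul]
  ring

/-- Averages at two centres and the same scale. -/
lemma norm_rescaleSchwartz_sub_centre_le (hQ : 0 < Q)
    (hM : ∀ i : Fin n, LpNormLE (ENNReal.ofReal Q)
      (∂_{EuclideanSpace.single i (1 : ℝ)} (Lp.toTemperedDistribution g)) M)
    (hξ : ContDiff ℝ ∞ ξ) (hξR : ∀ z, 2 < ‖z‖ → ξ z = 0) (hB : ∀ z, ‖ξ z‖ ≤ B)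
    (x₁ x₂ : EuclideanSpace ℝ (Fin n)) {r : ℝ} (hr : 0 < r) :
    ‖Lp.toTemperedDistribution g (rescaleSchwartz hξ hξR hr x₂)
        - Lp.toTemperedDistribution g (rescaleSchwartz hξ hξR hr x₁)‖ ≤
      n * (volume.real (Metric.closedBall (0 : EuclideanSpace ℝ (Fin n)) 2)) ^ (1 - 1 / Q) * B * M
        * ‖x₂ - x₁‖ * r ^ (-((n : ℝ) / Q)) := by
  have hg := (Lp.memLp g).locallyIntegrable Fact.out
  -- The centre runs from `x₁` to `x₂` in unit time while the radius is fixed (`q = 0`).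
  have hd := fun s : ℝ => hasDerivAt_integral_rescale hξ hξR hg x₁ (x₂ - x₁) r 0 s (by simpa)
  have key := norm_image_sub_le_of_norm_deriv_le_segment_01'
    (C := n * (volume.real (Metric.closedBall (0 : EuclideanSpace ℝ (Fin n)) 2)) ^ (1 - 1 / Q)
      * B * M * ‖x₂ - x₁‖ * r ^ (-((n : ℝ) / Q)))
    (fun s _ => (hd s).hasDerivWithinAt)
    (fun s _ => (norm_integral_sum_fderiv_flux_le hQ hM hξ hξR hB (x₂ - x₁) (x₁ + s • (x₂ - x₁)) 0
      (r := r + s * 0) (by simpa)).trans_eq (by simp))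
  simpa [toTemperedDistribution_rescaleSchwartz] using key

/-- Averages at two scales and the same centre. -/
lemma norm_rescaleSchwartz_sub_scale_le (hQ : (n : ℝ) < Q) (hM0 : 0 ≤ M)
    (hM : ∀ i : Fin n, LpNormLE (ENNReal.ofReal Q)
      (∂_{EuclideanSpace.single i (1 : ℝ)} (Lp.toTemperedDistribution g)) M)
    (hξ : ContDiff ℝ ∞ ξ) (hξR : ∀ z, 2 < ‖z‖ → ξ z = 0) (hB : ∀ z, ‖ξ z‖ ≤ B)
    (x : EuclideanSpace ℝ (Fin n)) {s r : ℝ} (hs : 0 < s) (hr : 0 < r) (hsr : s ≤ r) :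
    ‖Lp.toTemperedDistribution g (rescaleSchwartz hξ hξR hr x)
        - Lp.toTemperedDistribution g (rescaleSchwartz hξ hξR hs x)‖ ≤
      n * (volume.real (Metric.closedBall (0 : EuclideanSpace ℝ (Fin n)) 2)) ^ (1 - 1 / Q) * B * M
        * 2 / (1 - (n : ℝ) / Q) * r ^ (1 - (n : ℝ) / Q) := by
  have hB0 : 0 ≤ B := (norm_nonneg _).trans (hB 0)
  have hQ0 : 0 < Q := (Nat.cast_nonneg n).trans_lt hQ
  have hα : 0 < 1 - (n : ℝ) / Q := by rw [sub_pos, div_lt_one hQ0]; exact hQ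
  have hg := (Lp.memLp g).locallyIntegrable Fact.out
  set α := 1 - (n : ℝ) / Q with hαdef
  set c := n * (volume.real (Metric.closedBall (0 : EuclideanSpace ℝ (Fin n)) 2)) ^ (1 - 1 / Q)
    * B * M * 2 with hc
  have hc0 : 0 ≤ c := by positivity
  -- With `e = 0`, `r₀ = 0` and `q = 1` the parameter `t` is the radius itself.
  have hd := fun (t : ℝ) (ht : s ≤ t) =>
    hasDerivAt_integral_rescale hξ hξR hg x 0 0 1 t (by linarith)
  -- A primitive of the derivative bound `c t^(-n/Q)`. It stays bounded as `s → 0` because `α > 0`;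
  -- this is where `Q > n` enters.
  have hbd : ∀ t, s ≤ t → HasDerivAt (fun t : ℝ => c / α * (t ^ α - s ^ α))
      (c * t ^ (-((n : ℝ) / Q))) t := fun t ht => by
    convert! ((Real.hasDerivAt_rpow_const (p := α)
      (Or.inl (hs.trans_le ht).ne')).sub_const (s ^ α)).const_mul (c / α) using 1
    rw [show α - 1 = -((n : ℝ) / Q) by rw [hαdef]; ring]
    field_simp
  have key := image_norm_le_of_norm_deriv_right_le_deriv_boundary' (a := s) (b := r)
    (f := fun t => (∫ y, rescale ξ (0 + t * 1) (x + t • 0) y • g y)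
      - ∫ y, rescale ξ (0 + s * 1) (x + s • 0) y • g y)
    (fun t ht => ((hd t ht.1).sub_const _).continuousAt.continuousWithinAt)
    (fun t ht => ((hd t ht.1).sub_const _).hasDerivWithinAt)
    (B := fun t => c / α * (t ^ α - s ^ α)) (by simp)
    (fun t ht => (hbd t ht.1).continuousAt.continuousWithinAt)
    (fun t ht => (hbd t ht.1).hasDerivWithinAt)
    (fun t ht => (norm_integral_sum_fderiv_flux_le hQ0 hM hξ hξR hB 0 (x + t • 0) 1
      (r := 0 + t * 1) (by linarith [ht.1])).trans_eq (by
        simp [hc])) (right_mem_Icc.2 hsr)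
  simp only [zero_add, mul_one, smul_zero, add_zero] at key
  rw [toTemperedDistribution_rescaleSchwartz, toTemperedDistribution_rescaleSchwartz]
  refine key.trans ?_
  gcongr
  linarith [Real.rpow_nonneg hs.le α]

end Morrey

/-! ### The mollifier and its common constant. -/

section Mollifier

/-- The bump function equal to `1` on the ball of radius `r` and supported in that of radius
`2 * r`. -/
def doublingBump (n : ℕ) {r : ℝ} (hr : 0 < r) :
    ContDiffBump (0 : EuclideanSpace ℝ (Fin n)) where
  rIn := r
  rOut := 2 * r
  rIn_pos := hr
  rIn_lt_rOut := by linarith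

/-- A smooth probability density supported in the ball of radius `2`. -/
noncomputable def mollifier (n : ℕ) : EuclideanSpace ℝ (Fin n) → ℝ :=
  (doublingBump n one_pos).normed volume

lemma contDiff_mollifier (n : ℕ) : ContDiff ℝ ∞ (mollifier n) :=
  ContDiffBump.contDiff_normed _

lemma mollifier_eq_zero (n : ℕ) (z : EuclideanSpace ℝ (Fin n)) (hz : 2 < ‖z‖) :
    mollifier n z = 0 := by
  rw [← Function.notMem_support, mollifier, ContDiffBump.support_normed_eq]
  simpa [doublingBump] using hz.le

/-- The ratio of outer to inner radius is always `2`, so all these bumps are dilates of one another.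
This identifies the mollifier at scale `r` with a normalised `ContDiffBump`, to which the almost
everywhere convergence theorem applies. -/
lemma normed_doublingBump (n : ℕ) {r : ℝ} (hr : 0 < r) (z : EuclideanSpace ℝ (Fin n)) :
    (doublingBump n hr).normed volume z = (r ^ n)⁻¹ * mollifier n (r⁻¹ • z) := by
  have h1 : ∀ z, doublingBump n hr z = doublingBump n one_pos (r⁻¹ • z) := fun z => by
    simp only [ContDiffBump.apply, doublingBump]
    rw [mul_div_assoc, div_self hr.ne']
    simp
  have h2 : ∫ z, doublingBump n hr z = r ^ n * ∫ z, doublingBump n one_pos z := by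
    simp_rw [h1]
    rw [Measure.integral_comp_inv_smul_of_nonneg _ _ hr.le, finrank_euclideanSpace_fin,
      smul_eq_mul]
  rw [mollifier, ContDiffBump.normed_def, ContDiffBump.normed_def, h2, h1]
  field_simp

open Classical in
/-- The mollifier at scale `r` centred at `x`, as a test function. -/
noncomputable def mollifierAt (n : ℕ) (r : ℝ) (x : EuclideanSpace ℝ (Fin n)) :
    𝓢(EuclideanSpace ℝ (Fin n), ℂ) :=
  if hr : 0 < r then rescaleSchwartz (contDiff_mollifier n) (mollifier_eq_zero n) hr x else 0

lemma mollifierAt_of_pos {n : ℕ} {r : ℝ} (hr : 0 < r) (x : EuclideanSpace ℝ (Fin n)) :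
    mollifierAt n r x = rescaleSchwartz (contDiff_mollifier n) (mollifier_eq_zero n) hr x :=
  dif_pos hr

variable {F : Type*} [NormedAddCommGroup F] [NormedSpace ℂ F] [CompleteSpace F]

/-- Mollifications of an `L^p` function converge almost everywhere. -/
lemma ae_tendsto_mollifierAt {n : ℕ} {p : ℝ≥0∞} [Fact (1 ≤ p)]
    (g : Lp F p (volume : Measure (EuclideanSpace ℝ (Fin n)))) :
    ∀ᵐ x, Filter.Tendsto
      (fun k : ℕ => Lp.toTemperedDistribution g (mollifierAt n (1 / ((k : ℝ) + 1)) x))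
      Filter.atTop (nhds (g x)) := by
  have hk : ∀ k : ℕ, 0 < 1 / ((k : ℝ) + 1) := fun k => by positivity
  have hlim : Filter.Tendsto (fun k : ℕ => (doublingBump n (hk k)).rOut) Filter.atTop (nhds 0) := by
    simpa [doublingBump] using (tendsto_one_div_add_atTop_nhds_zero_nat (𝕜 := ℝ)).const_mul 2
  have hg := (Lp.memLp g).locallyIntegrable Fact.out
  -- `K := 2` is the fixed ratio of the radii; its boundedness is what Lebesgue differentiation
  -- needs.
  filter_upwards [ContDiffBump.ae_convolution_tendsto_right_of_locallyIntegrable (K := 2) hlim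
    (.of_forall fun k => le_rfl) hg] with x hx
  refine hx.congr fun k => ?_
  rw [mollifierAt_of_pos (hk k), toTemperedDistribution_rescaleSchwartz, convolution_eq_swap]
  refine integral_congr_ae (.of_forall fun y => ?_)
  simp only [ContinuousLinearMap.lsmul_apply, normed_doublingBump, rescale]

/-- The estimates for mollifications of `L^Q` distributions, with a common constant. -/
lemma exists_mollifierAt_bound (n : ℕ) {Q : ℝ} (hQ : (n : ℝ) < Q)
    [Fact (1 ≤ ENNReal.ofReal Q)] :
    ∃ K : ℝ, 0 ≤ K ∧
      (∀ (w : 𝓢'(EuclideanSpace ℝ (Fin n), F)) (c : ℝ), LpNormLE (ENNReal.ofReal Q) w c →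
        ∀ r, 0 < r → ∀ x, ‖w (mollifierAt n r x)‖ ≤ K * c * r ^ (-((n : ℝ) / Q))) ∧
      ∀ (g : Lp F (ENNReal.ofReal Q) (volume : Measure (EuclideanSpace ℝ (Fin n)))) (M : ℝ),
        0 ≤ M → (∀ i : Fin n, LpNormLE (ENNReal.ofReal Q)
          (∂_{EuclideanSpace.single i (1 : ℝ)} (Lp.toTemperedDistribution g)) M) →
        (∀ r, 0 < r → ∀ x₁ x₂,
          ‖Lp.toTemperedDistribution g (mollifierAt n r x₂)
            - Lp.toTemperedDistribution g (mollifierAt n r x₁)‖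
              ≤ K * M * ‖x₂ - x₁‖ * r ^ (-((n : ℝ) / Q))) ∧
        ∀ s r, 0 < s → s ≤ r → ∀ x,
          ‖Lp.toTemperedDistribution g (mollifierAt n r x)
            - Lp.toTemperedDistribution g (mollifierAt n s x)‖
              ≤ K * M * r ^ (1 - (n : ℝ) / Q) := by
  have hQ0 : 0 < Q := (Nat.cast_nonneg n).trans_lt hQ
  have hα : 0 < 1 - (n : ℝ) / Q := by rw [sub_pos, div_lt_one hQ0]; exact hQ
  obtain ⟨B, hB0, hB⟩ := exists_norm_le_of_norm_gt (contDiff_mollifier n).continuous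
    (mollifier_eq_zero n)
  set V := (volume.real (Metric.closedBall (0 : EuclideanSpace ℝ (Fin n)) 2)) ^ (1 - 1 / Q)
    with hV
  have hV0 : 0 ≤ V := by positivity
  have hK₁ : 0 ≤ V * B := by positivity
  have hK₂ : 0 ≤ n * V * B := by positivity
  have hK₃ : 0 ≤ n * V * B * 2 / (1 - (n : ℝ) / Q) := by positivity
  refine ⟨V * B + n * V * B + n * V * B * 2 / (1 - (n : ℝ) / Q), by positivity, ?_, ?_⟩
  · intro w c hw r hr x
    have hc : 0 ≤ c := by
      obtain ⟨h, -, hc⟩ := hw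
      exact (norm_nonneg h).trans hc
    rw [mollifierAt_of_pos hr]
    refine (hw.norm_rescaleSchwartz_le hQ0 (contDiff_mollifier n) (mollifier_eq_zero n) hB
      hr x).trans ?_
    gcongr
    linarith
  · intro g M hM0 hM
    refine ⟨fun r hr x₁ x₂ => ?_, fun s r hs hsr x => ?_⟩
    · rw [mollifierAt_of_pos hr, mollifierAt_of_pos hr]
      refine (norm_rescaleSchwartz_sub_centre_le hQ0 hM (contDiff_mollifier n)
        (mollifier_eq_zero n) hB x₁ x₂ hr).trans ?_
      gcongr
      linarith
    · have hr := hs.trans_le hsr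
      rw [mollifierAt_of_pos hr, mollifierAt_of_pos hs]
      refine (norm_rescaleSchwartz_sub_scale_le hQ hM0 hM (contDiff_mollifier n)
        (mollifier_eq_zero n) hB x hs hr hsr).trans ?_
      rw [← hV, show n * V * B * M * 2 / (1 - (n : ℝ) / Q)
        = n * V * B * 2 / (1 - (n : ℝ) / Q) * M by ring]
      gcongr
      linarith

end Mollifier

/-! ### From almost every time to every time. -/

section Time

/-- The continuous functions `max h c` and `c` agree almost everywhere, hence everywhere on a
nondegenerate interval. -/
lemma forall_mem_Icc_le_of_ae_le {a b c : ℝ} (hab : a < b) {h : ℝ → ℝ}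
    (hh : ContinuousOn h (Icc a b)) (hc : ∀ᵐ t ∂(volume.restrict (Icc a b)), h t ≤ c) :
    ∀ t ∈ Icc a b, h t ≤ c := by
  have := Measure.eqOn_Icc_of_ae_eq volume hab.ne (f := fun t => max (h t) c) (g := fun _ => c)
    (hc.mono fun t ht => max_eq_right ht) (hh.sup continuousOn_const) continuousOn_const
  exact fun t ht => max_eq_right_iff.1 (this ht)

variable {E F : Type*} [NormedAddCommGroup E] [InnerProductSpace ℝ E]
    [FiniteDimensional ℝ E] [MeasurableSpace E] [BorelSpace E]
    [NormedAddCommGroup F] [NormedSpace ℂ F] [CompleteSpace F]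

lemma SmoothInTime.continuousOn_apply {E F : Type*} [NormedAddCommGroup E] [NormedSpace ℝ E]
    [NormedAddCommGroup F] [NormedSpace ℂ F] {u : ℝ → 𝓢'(E, F)} (hu : SmoothInTime u) (φ : 𝓢(E, ℂ))
    (T : ℝ) : ContinuousOn (fun t => u t φ) (Icc 0 T) :=
  (hu φ).continuousOn.mono Icc_subset_Ici_self

lemma intervalIntegrable_of_locallyIntegrableOn_Ici {f : ℝ → ℝ}
    (hf : LocallyIntegrableOn f (Ici 0)) {a b : ℝ} (ha : 0 ≤ a) (hb : 0 ≤ b) :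
    IntervalIntegrable f volume a b := by
  refine (hf.integrableOn_compact_subset (t := uIcc a b) ?_ isCompact_uIcc).intervalIntegrable
  exact fun t ht => (le_min ha hb).trans ht.1

/-- Increments in time are controlled by a bound for the time derivative. -/
lemma norm_apply_sub_apply_le {E F : Type*} [NormedAddCommGroup E] [NormedSpace ℝ E]
    [NormedAddCommGroup F] [NormedSpace ℂ F] [CompleteSpace F] {u ut : ℝ → 𝓢'(E, F)} (hu : SmoothInTime u)
    (hut : IsTimeDeriv u ut) {f : ℝ → ℝ} (hf : LocallyIntegrableOn f (Ici 0)) {φ : 𝓢(E, ℂ)}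
    {c : ℝ} (hφ : ∀ᵐ t ∂(volume.restrict (Ici 0)), ‖ut t φ‖ ≤ c * f t) {t₁ t₂ : ℝ}
    (h₁ : 0 ≤ t₁) (h₁₂ : t₁ ≤ t₂) :
    ‖u t₂ φ - u t₁ φ‖ ≤ c * ∫ t in t₁..t₂, f t := by
  -- Smoothness in time makes `t ↦ ut t φ` continuous, so the fundamental theorem of calculus
  -- applies.
  have hcont : ContinuousOn (fun t => ut t φ) (Ici 0) :=
    ((hu φ).continuousOn_derivWithin (uniqueDiffOn_Ici 0) (by simp)).congr fun t ht =>
      ((hut φ t ht).derivWithin (uniqueDiffOn_Ici 0 t ht)).symm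
  have hsub : Icc t₁ t₂ ⊆ Ici 0 := fun t ht => h₁.trans ht.1
  rw [← intervalIntegral.integral_eq_sub_of_hasDeriv_right_of_le (f' := fun t => ut t φ) h₁₂
    ((hu φ).continuousOn.mono hsub)
    (fun t ht => (hut φ t (h₁.trans ht.1.le)).mono fun s hs => (h₁.trans ht.1.le).trans hs.le)
    ((hcont.mono hsub).intervalIntegrable_of_Icc h₁₂), ← intervalIntegral.integral_const_mul]
  refine intervalIntegral.norm_integral_le_of_norm_le h₁₂ ?_
    ((intervalIntegrable_of_locallyIntegrableOn_Ici hf h₁ (h₁.trans h₁₂)).const_mul c)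
  filter_upwards [(ae_restrict_iff' measurableSet_Ici).1 hφ] with t ht hmem
  exact ht (h₁.trans hmem.1.le)

lemma intervalIntegral_nonneg_of_ae_lpNormLE {p : ℝ≥0∞} [Fact (1 ≤ p)] {w : ℝ → 𝓢'(E, F)} {f : ℝ → ℝ}
    (h : ∀ᵐ t ∂(volume.restrict (Ici 0)), LpNormLE p (w t) (f t)) {t₁ t₂ : ℝ} (h₁ : 0 ≤ t₁)
    (h₁₂ : t₁ ≤ t₂) : 0 ≤ ∫ t in t₁..t₂, f t := by
  refine intervalIntegral.integral_nonneg_of_ae_restrict h₁₂ ?_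
  filter_upwards [ae_restrict_of_ae_restrict_of_subset
    (fun t ht => h₁.trans ht.1 : Icc t₁ t₂ ⊆ Ici 0) h] with t ⟨g, _, hg⟩
  exact (norm_nonneg g).trans hg

/-- A family in `L^∞_loc([0,∞); L^p)` is bounded in `L^p` on `[0,T]`. -/
lemma MemLocBochner.exists_ae_lpNormLE {p : ℝ≥0∞} [Fact (1 ≤ p)] {w : ℝ → 𝓢'(E, F)}
    (hw : MemLocBochner (⊤ : ℝ≥0∞) p w) {T : ℝ} (hT : 0 < T) :
    ∃ c, 0 ≤ c ∧ ∀ᵐ t ∂(volume.restrict (Icc 0 T)), LpNormLE p (w t) c := by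
  obtain ⟨g, hg, hmem⟩ := hw
  refine ⟨(eLpNorm g ⊤ (volume.restrict (Icc 0 T))).toReal, ENNReal.toReal_nonneg, ?_⟩
  have hb : ∀ᵐ t ∂(volume.restrict (Icc 0 T)),
      ‖g t‖ₑ ≤ eLpNorm g ⊤ (volume.restrict (Icc 0 T)) := by
    rw [eLpNorm_exponent_top]
    exact enorm_ae_le_eLpNormEssSup g _
  filter_upwards [ae_restrict_of_ae_restrict_of_subset Icc_subset_Ici_self hg, hb] with t h1 h2
  refine ⟨g t, h1, ?_⟩
  rw [← toReal_enorm]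
  exact ENNReal.toReal_mono (hmem T hT).2.ne h2

end Time

/-! ### Hölder estimates for the limit of averages. -/

section Holder

open Filter Topology

/-- Averages exist only at positive scales, while the natural scale `δ` may be `0`; hence every `ρ >
δ` is used and `ρ` decreases to `δ`. -/
lemma le_mul_rpow_of_forall_gt {a C α δ : ℝ} (hα : 0 ≤ α)
    (h : ∀ ρ, δ < ρ → a ≤ C * ρ ^ α) : a ≤ C * δ ^ α := by
  have hc : Tendsto (fun ρ : ℝ => C * ρ ^ α) (𝓝[>] δ) (𝓝 (C * δ ^ α)) :=
    ((Real.continuous_rpow_const hα).const_mul C).continuousAt.tendsto.mono_left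
      nhdsWithin_le_nhds
  exact ge_of_tendsto hc (eventually_mem_nhdsWithin.mono fun ρ hρ => h ρ hρ)

lemma rpow_neg_mul_le {ν ρ δ : ℝ} (hρ : 0 < ρ) (hδρ : δ ≤ ρ) :
    δ * ρ ^ (-ν) ≤ ρ ^ (1 - ν) := by
  rw [sub_eq_add_neg, Real.rpow_add hρ, Real.rpow_one]
  gcongr

variable {E F : Type*} [NormedAddCommGroup E] [NormedAddCommGroup F]

/-- Existence of the limit along the scales `1 / (k + 1)`. -/
lemma exists_tendsto_of_scale_bound [CompleteSpace F] {A : ℝ → F} {D α : ℝ} (hα : 0 < α)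
    (h : ∀ s r, 0 < s → s ≤ r → ‖A r - A s‖ ≤ D * r ^ α) :
    ∃ L, Tendsto (fun k : ℕ => A (1 / ((k : ℝ) + 1))) atTop (𝓝 L) := by
  refine cauchySeq_tendsto_of_complete (cauchySeq_of_le_tendsto_0'
    (fun k : ℕ => D * (1 / ((k : ℝ) + 1)) ^ α) (fun k m hkm => ?_) ?_)
  · rw [dist_eq_norm]
    refine h _ _ (by positivity) ?_
    gcongr
  · have := ((Real.continuous_rpow_const hα.le).const_mul D).continuousAt.tendsto.comp
      (tendsto_one_div_add_atTop_nhds_zero_nat (𝕜 := ℝ))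
    simpa [Real.zero_rpow hα.ne', Function.comp_def] using this

lemma norm_sub_limit_le {A : ℝ → F} {L : F} {D α : ℝ}
    (h : ∀ s r, 0 < s → s ≤ r → ‖A r - A s‖ ≤ D * r ^ α)
    (hL : Tendsto (fun k : ℕ => A (1 / ((k : ℝ) + 1))) atTop (𝓝 L)) {r : ℝ} (hr : 0 < r) :
    ‖A r - L‖ ≤ D * r ^ α := by
  refine le_of_tendsto (hL.const_sub (A r)).norm ?_
  filter_upwards [(tendsto_one_div_add_atTop_nhds_zero_nat (𝕜 := ℝ)).eventually_le_const hr]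
    with k hk
  exact h _ _ (by positivity) hk

/-- The Hölder estimate in space for the limit of averages. -/
lemma norm_limit_sub_limit_centre_le {A : ℝ → E → F} {v : E → F} {D ν : ℝ} (hν : ν ≤ 1)
    (hD : 0 ≤ D) (hv : ∀ r, 0 < r → ∀ x, ‖A r x - v x‖ ≤ D * r ^ (1 - ν))
    (hA : ∀ r, 0 < r → ∀ x₁ x₂, ‖A r x₂ - A r x₁‖ ≤ D * ‖x₂ - x₁‖ * r ^ (-ν)) (x₁ x₂ : E) :
    ‖v x₂ - v x₁‖ ≤ 3 * D * ‖x₂ - x₁‖ ^ (1 - ν) := by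
  refine le_mul_rpow_of_forall_gt (by linarith) fun ρ hρ => ?_
  have hρ0 : 0 < ρ := (norm_nonneg _).trans_lt hρ
  have h1 := hv ρ hρ0 x₁
  have h2 := hv ρ hρ0 x₂
  have h3 := hA ρ hρ0 x₁ x₂
  have h4 : D * ‖x₂ - x₁‖ * ρ ^ (-ν) ≤ D * ρ ^ (1 - ν) := by
    rw [mul_assoc]
    exact mul_le_mul_of_nonneg_left (rpow_neg_mul_le hρ0 hρ.le) hD
  calc ‖v x₂ - v x₁‖ = ‖(A ρ x₂ - A ρ x₁) + (A ρ x₁ - v x₁) - (A ρ x₂ - v x₂)‖ := by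
        congr 1; abel
    _ ≤ ‖A ρ x₂ - A ρ x₁‖ + ‖A ρ x₁ - v x₁‖ + ‖A ρ x₂ - v x₂‖ :=
        (norm_sub_le _ _).trans (add_le_add_left (norm_add_le _ _) _)
    _ ≤ 3 * D * ρ ^ (1 - ν) := by linarith

/-- The Hölder estimate in time for the limit of averages. -/
lemma norm_limit_sub_limit_le {A₁ A₂ : ℝ → F} {v₁ v₂ : F} {D K δ ν : ℝ} (hν : ν ≤ 1)
    (hK : 0 ≤ K) (hδ : 0 ≤ δ) (h₁ : ∀ r, 0 < r → ‖A₁ r - v₁‖ ≤ D * r ^ (1 - ν))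
    (h₂ : ∀ r, 0 < r → ‖A₂ r - v₂‖ ≤ D * r ^ (1 - ν))
    (hA : ∀ r, 0 < r → ‖A₂ r - A₁ r‖ ≤ K * r ^ (-ν) * δ) :
    ‖v₂ - v₁‖ ≤ (2 * D + K) * δ ^ (1 - ν) := by
  refine le_mul_rpow_of_forall_gt (by linarith) fun ρ hρ => ?_
  have hρ0 : 0 < ρ := hδ.trans_lt hρ
  have h1 := h₁ ρ hρ0
  have h2 := h₂ ρ hρ0
  have h3 := hA ρ hρ0
  have h4 : K * ρ ^ (-ν) * δ ≤ K * ρ ^ (1 - ν) := by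
    rw [mul_assoc, mul_comm _ δ]
    exact mul_le_mul_of_nonneg_left (rpow_neg_mul_le hρ0 hρ.le) hK
  calc ‖v₂ - v₁‖ = ‖(A₂ ρ - A₁ ρ) + (A₁ ρ - v₁) - (A₂ ρ - v₂)‖ := by
        congr 1; abel
    _ ≤ ‖A₂ ρ - A₁ ρ‖ + ‖A₁ ρ - v₁‖ + ‖A₂ ρ - v₂‖ :=
        (norm_sub_le _ _).trans (add_le_add_left (norm_add_le _ _) _)
    _ ≤ (2 * D + K) * ρ ^ (1 - ν) := by linarith

/-- A Hölder estimate in space and in the primitive of `f` gives joint continuity. -/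
lemma continuousOn_of_holder_estimate {v : E → ℝ → F} {f : ℝ → ℝ} {T C α : ℝ} (hα : 0 < α)
    (hf : LocallyIntegrableOn f (Ici 0))
    (h : ∀ x₁ x₂ t₁ t₂, 0 ≤ t₁ → t₁ ≤ t₂ → t₂ ≤ T →
      ‖v x₂ t₂ - v x₁ t₁‖ ≤ C * (‖x₂ - x₁‖ ^ α + (∫ t in t₁..t₂, f t) ^ α)) :
    ContinuousOn (fun z : E × ℝ => v z.1 z.2) (univ ×ˢ Icc 0 T) := by
  rintro ⟨x₀, t₀⟩ ⟨-, ht₀⟩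
  have hint : IntegrableOn f (uIcc 0 T) :=
    hf.integrableOn_compact_subset (fun t ht => by
      rw [uIcc_of_le (ht₀.1.trans ht₀.2)] at ht
      exact ht.1) isCompact_uIcc
  have hΦ : ContinuousOn (fun t => ∫ s in 0..t, f s) (Icc 0 T) := by
    have := intervalIntegral.continuousOn_primitive_interval hint
    rwa [uIcc_of_le (ht₀.1.trans ht₀.2)] at this
  have hdiff : ∀ a b, 0 ≤ a → 0 ≤ b →
      ∫ t in a..b, f t = (∫ t in 0..b, f t) - ∫ t in 0..a, f t := fun a b ha hb =>
    (intervalIntegral.integral_interval_sub_left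
      (intervalIntegrable_of_locallyIntegrableOn_Ici hf le_rfl hb)
      (intervalIntegrable_of_locallyIntegrableOn_Ici hf le_rfl ha)).symm
  have hΦ' : ContinuousOn (fun z : E × ℝ => ∫ s in 0..z.2, f s) (univ ×ˢ Icc 0 T) :=
    hΦ.comp continuousOn_snd fun z hz => hz.2
  have hp : Continuous fun s : ℝ => s ^ α := Real.continuous_rpow_const hα.le
  have hlim : ContinuousWithinAt (fun z : E × ℝ =>
      |C| * (‖z.1 - x₀‖ ^ α + |(∫ s in 0..z.2, f s) - ∫ s in 0..t₀, f s| ^ α))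
      (univ ×ˢ Icc 0 T) (x₀, t₀) := by
    refine continuousWithinAt_const.mul (.add ?_ ?_)
    · exact (hp.comp (continuous_fst.sub continuous_const).norm).continuousWithinAt
    · exact hp.continuousAt.comp_continuousWithinAt
        (((hΦ' (x₀, t₀) ⟨mem_univ _, ht₀⟩).sub continuousWithinAt_const).abs)
  rw [ContinuousWithinAt, tendsto_iff_norm_sub_tendsto_zero]
  refine squeeze_zero' (.of_forall fun _ => norm_nonneg _) ?_
    (by simpa [ContinuousWithinAt, Real.zero_rpow hα.ne'] using hlim)
  filter_upwards [self_mem_nhdsWithin] with z hz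
  -- Neither `C` nor the integral is known to be nonnegative here, so absolute values are inserted
  -- before squeezing.
  have hIabs : ∀ I : ℝ, C * (‖z.1 - x₀‖ ^ α + I ^ α) ≤ |C| * (‖z.1 - x₀‖ ^ α + |I| ^ α) := by
    intro I
    refine (le_abs_self _).trans ?_
    rw [abs_mul]
    gcongr
    refine (abs_add_le _ _).trans ?_
    rw [abs_of_nonneg (Real.rpow_nonneg (norm_nonneg _) α)]
    gcongr
    exact Real.abs_rpow_le_abs_rpow _ _
  rcases le_total t₀ z.2 with hle | hle
  · have := h x₀ z.1 t₀ z.2 ht₀.1 hle hz.2.2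
    rw [hdiff _ _ ht₀.1 hz.2.1] at this
    exact this.trans (hIabs _)
  · have := h z.1 x₀ z.2 t₀ hz.2.1 hle ht₀.2
    rw [hdiff _ _ hz.2.1 ht₀.1, norm_sub_rev, norm_sub_rev x₀] at this
    refine (this.trans (hIabs _)).trans_eq ?_
    rw [abs_sub_comm]

end Holder

/-! ### Representation by a continuous function at every time. -/

section Representation

variable {E F : Type*} [NormedAddCommGroup E] [InnerProductSpace ℝ E]
    [FiniteDimensional ℝ E] [MeasurableSpace E] [BorelSpace E]
    [NormedAddCommGroup F] [NormedSpace ℂ F]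

lemma integrable_schwartz_smul_of_bounded {v : E → F} (hv : Continuous v) {D : ℝ}
    (hD : ∀ x, ‖v x‖ ≤ D) (φ : 𝓢(E, ℂ)) : Integrable fun x => φ x • v x := by
  refine (φ.integrable.norm.mul_const D).mono'
    (φ.continuous.smul hv).aestronglyMeasurable (.of_forall fun x => ?_)
  rw [norm_smul]
  gcongr
  exact hD x

/-- A family of distributions, continuous in time, is represented at every time by a bounded
jointly continuous function that represents it at almost every time. -/
lemma representedBy_of_ae {u : ℝ → 𝓢'(E, F)} (hu : SmoothInTime u) {v : E → ℝ → F} {T D : ℝ}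
    (hT : 0 < T) (hv : ContinuousOn (fun z : E × ℝ => v z.1 z.2) (univ ×ˢ Icc 0 T))
    (hD : ∀ x, ∀ t ∈ Icc 0 T, ‖v x t‖ ≤ D)
    (hrep : ∀ᵐ t ∂(volume.restrict (Icc 0 T)), ∀ φ : 𝓢(E, ℂ), u t φ = ∫ x, φ x • v x t) :
    ∀ t ∈ Icc 0 T, RepresentedBy (u t) (fun x => v x t) := by
  have hvx : ∀ t ∈ Icc 0 T, Continuous fun x => v x t := fun t ht =>
    hv.comp_continuous (f := fun x : E => (x, t)) (by fun_prop) fun x => ⟨mem_univ _, ht⟩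
  intro t ht φ
  refine ⟨integrable_schwartz_smul_of_bounded (hvx t ht) (fun x => hD x t ht) φ, ?_⟩
  refine Measure.eqOn_Icc_of_ae_eq volume hT.ne (f := fun t => u t φ)
    (g := fun t => ∫ x, φ x • v x t) (hrep.mono fun t h => h φ) (hu.continuousOn_apply φ T) ?_ ht
  -- Dominated convergence makes the pairing with `v` continuous in time, so it agrees with `u t φ`
  -- everywhere.
  refine continuousOn_of_dominated (bound := fun x => ‖φ x‖ * D)
    (fun s hs => (φ.continuous.smul (hvx s hs)).aestronglyMeasurable)
    (fun s hs => .of_forall fun x => ?_) (φ.integrable.norm.mul_const D)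
    (.of_forall fun x => ?_)
  · rw [norm_smul]
    gcongr
    exact hD x s hs
  · exact continuousOn_const.smul (hv.comp (f := fun s : ℝ => (x, s)) (by fun_prop)
      fun s hs => ⟨mem_univ _, hs⟩)

end Representation

/-! ### Averages of `u` at every time. -/

section Mollification

open Filter Topology

variable {F : Type*} [NormedAddCommGroup F] [NormedSpace ℂ F] [CompleteSpace F] {n : ℕ}

/-- Gradient bounds at almost every time control the mollifications at every time. -/
lemma mollifierAt_bounds_of_ae {Q K : ℝ} [Fact (1 ≤ ENNReal.ofReal Q)]
    (hK : ∀ (g : Lp F (ENNReal.ofReal Q) (volume : Measure (EuclideanSpace ℝ (Fin n)))) (M : ℝ),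
        0 ≤ M → (∀ i : Fin n, LpNormLE (ENNReal.ofReal Q)
          (∂_{EuclideanSpace.single i (1 : ℝ)} (Lp.toTemperedDistribution g)) M) →
        (∀ r, 0 < r → ∀ x₁ x₂,
          ‖Lp.toTemperedDistribution g (mollifierAt n r x₂)
            - Lp.toTemperedDistribution g (mollifierAt n r x₁)‖
              ≤ K * M * ‖x₂ - x₁‖ * r ^ (-((n : ℝ) / Q))) ∧
        ∀ s r, 0 < s → s ≤ r → ∀ x,
          ‖Lp.toTemperedDistribution g (mollifierAt n r x)
            - Lp.toTemperedDistribution g (mollifierAt n s x)‖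
              ≤ K * M * r ^ (1 - (n : ℝ) / Q))
    {u : ℝ → 𝓢'(EuclideanSpace ℝ (Fin n), F)} (hu : SmoothInTime u)
    (huQ : MemLocBochner (⊤ : ℝ≥0∞) (ENNReal.ofReal Q) u) {T M : ℝ} (hT : 0 < T) (hM0 : 0 ≤ M)
    (hM : ∀ᵐ t : ℝ ∂(volume.restrict (Icc 0 T)), ∀ i : Fin n,
      LpNormLE (ENNReal.ofReal Q) (∂_{EuclideanSpace.single i (1 : ℝ)} (u t)) M) :
    ∀ t ∈ Icc 0 T,
      (∀ r, 0 < r → ∀ x₁ x₂, ‖u t (mollifierAt n r x₂) - u t (mollifierAt n r x₁)‖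
        ≤ K * M * ‖x₂ - x₁‖ * r ^ (-((n : ℝ) / Q))) ∧
      ∀ s r, 0 < s → s ≤ r → ∀ x, ‖u t (mollifierAt n r x) - u t (mollifierAt n s x)‖
        ≤ K * M * r ^ (1 - (n : ℝ) / Q) := by
  obtain ⟨g, hg, -⟩ := huQ
  have hgT := ae_restrict_of_ae_restrict_of_subset 
    (Icc_subset_Ici_self : Icc 0 T ⊆ Ici 0) hg
  refine fun t ht => ⟨fun r hr x₁ x₂ => ?_, fun s r hs hsr x => ?_⟩
  -- For fixed test functions the left side is continuous in time and the right side is constant, so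
  -- the exceptional null set disappears.
  · refine forall_mem_Icc_le_of_ae_le hT
      (((hu.continuousOn_apply _ T).sub (hu.continuousOn_apply _ T)).norm) ?_ t ht
    filter_upwards [hgT, hM] with τ h1 h2
    rw [← h1] at h2
    have := (hK (g τ) M hM0 h2).1 r hr x₁ x₂
    rwa [h1] at this
  · refine forall_mem_Icc_le_of_ae_le hT
      (((hu.continuousOn_apply _ T).sub (hu.continuousOn_apply _ T)).norm) ?_ t ht
    filter_upwards [hgT, hM] with τ h1 h2
    rw [← h1] at h2
    have := (hK (g τ) M hM0 h2).2 s r hs hsr x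
    rwa [h1] at this

end Mollification

/-! ### Assembly of the theorem. -/

theorem proposition9p3 {F : Type*} [NormedAddCommGroup F] [NormedSpace ℂ F] [CompleteSpace F]
    (n : ℕ) (hn : 1 ≤ n) (Q : ℝ) (hQ : (n : ℝ) < Q) [Fact (1 ≤ ENNReal.ofReal Q)] :
    -- `C M` depends only on `n`, `Q` and the bound `M` for `∂ₓu` in `L^∞([0,T]; L^Q)`
    ∃ C : ℝ → ℝ,
      ∀ (u ut : ℝ → 𝓢'(EuclideanSpace ℝ (Fin n), F)) (f : ℝ → ℝ),
        SmoothInTime u →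
        MemLocBochner ∞ (ENNReal.ofReal Q) u →
        (∀ i : Fin n, MemLocBochner ∞ (ENNReal.ofReal Q)
          (fun t => ∂_{EuclideanSpace.single i (1 : ℝ)} (u t))) →
        IsTimeDeriv u ut →
        MemLocBochner 1 (ENNReal.ofReal Q) ut →
        LocallyIntegrableOn f (Ici 0) volume →
        (∀ᵐ t : ℝ ∂(volume.restrict (Ici 0)), LpNormLE (ENNReal.ofReal Q) (ut t) (f t)) →
        ∃ v : EuclideanSpace ℝ (Fin n) → ℝ → F,
          (∀ t : ℝ, 0 ≤ t → RepresentedBy (u t) (fun x => v x t)) ∧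
          ∀ T : ℝ, 0 < T →
            ContinuousOn (fun z : EuclideanSpace ℝ (Fin n) × ℝ => v z.1 z.2)
              (univ ×ˢ Icc 0 T) ∧
            ∀ M : ℝ,
              (∀ᵐ t : ℝ ∂(volume.restrict (Icc 0 T)), ∀ i : Fin n,
                LpNormLE (ENNReal.ofReal Q)
                  (∂_{EuclideanSpace.single i (1 : ℝ)} (u t)) M) →
              ∀ (x₁ x₂ : EuclideanSpace ℝ (Fin n)) (t₁ t₂ : ℝ),
                ‖x₁ - x₂‖ ≤ 1 → 0 ≤ t₁ → t₁ ≤ t₂ → t₂ ≤ T →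
                (∫ t in t₁..t₂, f t) ≤ 1 →
                ‖v x₂ t₂ - v x₁ t₁‖ ≤
                  C M * (‖x₂ - x₁‖ ^ (1 - (n : ℝ) / Q)
                    + (∫ t in t₁..t₂, f t) ^ (1 - (n : ℝ) / Q)) := by
  have hQ0 : 0 < Q := (Nat.cast_nonneg n).trans_lt hQ
  have hν : (n : ℝ) / Q < 1 := (div_lt_one hQ0).2 hQ
  have hα : 0 < 1 - (n : ℝ) / Q := sub_pos.2 hν
  obtain ⟨K, hK0, hKpair, hKgrad⟩ := exists_mollifierAt_bound (F := F) n hQ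
  -- Space contributes `3KM` and time `2KM + K`; for `M ≥ 0` both are at most `K(3M + 1)`.
  refine ⟨fun M => K * (3 * M + 1), fun u ut f hu huQ hgrad hut _ hf hfut => ?_⟩
  -- Some gradient bound exists on each `[0,T]`, so `v` can be built before any `M` is prescribed.
  -- The sum over `i` serves all directions at once.
  have hgradM : ∀ T, 0 < T → ∃ M, 0 ≤ M ∧
      ∀ᵐ t : ℝ ∂(volume.restrict (Icc 0 T)), ∀ i : Fin n,
        LpNormLE (ENNReal.ofReal Q) (∂_{EuclideanSpace.single i (1 : ℝ)} (u t)) M := by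
    intro T hT
    choose c hc0 hc using fun i => (hgrad i).exists_ae_lpNormLE hT
    refine ⟨∑ i, c i, Finset.sum_nonneg fun i _ => hc0 i, ?_⟩
    filter_upwards [ae_all_iff.2 hc] with t ht i
    obtain ⟨g, hg, hgc⟩ := ht i
    exact ⟨g, hg, hgc.trans (Finset.single_le_sum (fun i _ => hc0 i) (Finset.mem_univ i))⟩
  have hlim : ∀ t, 0 ≤ t → ∀ x, ∃ L, Filter.Tendsto
      (fun k : ℕ => u t (mollifierAt n (1 / ((k : ℝ) + 1)) x)) Filter.atTop (nhds L) := by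
    intro t ht x
    -- The endpoint `t + 1` keeps the time interval nondegenerate when `t = 0`.
    obtain ⟨M, hM0, hM⟩ := hgradM (t + 1) (by linarith)
    have := mollifierAt_bounds_of_ae hKgrad hu huQ (by linarith) hM0 hM t ⟨ht, by linarith⟩
    exact exists_tendsto_of_scale_bound (A := fun r => u t (mollifierAt n r x)) hα
      fun s r hs hsr => this.2 s r hs hsr x
  let v : EuclideanSpace ℝ (Fin n) → ℝ → F := fun x t =>
    Filter.limUnder Filter.atTop (fun k : ℕ => u t (mollifierAt n (1 / ((k : ℝ) + 1)) x))
  have hv : ∀ t, 0 ≤ t → ∀ x, Filter.Tendsto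
      (fun k : ℕ => u t (mollifierAt n (1 / ((k : ℝ) + 1)) x)) Filter.atTop (nhds (v x t)) :=
    fun t ht x => tendsto_nhds_limUnder (hlim t ht x)
  have happrox : ∀ T M, 0 < T → 0 ≤ M → (∀ᵐ t : ℝ ∂(volume.restrict (Icc 0 T)), ∀ i : Fin n,
      LpNormLE (ENNReal.ofReal Q) (∂_{EuclideanSpace.single i (1 : ℝ)} (u t)) M) →
      ∀ t ∈ Icc 0 T, ∀ r, 0 < r → ∀ x,
        ‖u t (mollifierAt n r x) - v x t‖ ≤ K * M * r ^ (1 - (n : ℝ) / Q) :=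
    fun T M hT hM0 hM t ht r hr x =>
      norm_sub_limit_le (A := fun r => u t (mollifierAt n r x)) (fun s r hs hsr =>
        (mollifierAt_bounds_of_ae hKgrad hu huQ hT hM0 hM t ht).2 s r hs hsr x) (hv t ht.1 x) hr
  have hest : ∀ T M, 0 < T → 0 ≤ M → (∀ᵐ t : ℝ ∂(volume.restrict (Icc 0 T)), ∀ i : Fin n,
      LpNormLE (ENNReal.ofReal Q) (∂_{EuclideanSpace.single i (1 : ℝ)} (u t)) M) →
      ∀ (x₁ x₂ : EuclideanSpace ℝ (Fin n)) (t₁ t₂ : ℝ), 0 ≤ t₁ → t₁ ≤ t₂ → t₂ ≤ T →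
        ‖v x₂ t₂ - v x₁ t₁‖ ≤ K * (3 * M + 1) * (‖x₂ - x₁‖ ^ (1 - (n : ℝ) / Q)
          + (∫ t in t₁..t₂, f t) ^ (1 - (n : ℝ) / Q)) := by
    intro T M hT hM0 hM x₁ x₂ t₁ t₂ h₁ h₁₂ h₂
    have hδ := intervalIntegral_nonneg_of_ae_lpNormLE hfut h₁ h₁₂
    have hKM : 0 ≤ K * M := by positivity
    have hspace : ‖v x₂ t₂ - v x₁ t₂‖ ≤ 3 * (K * M) * ‖x₂ - x₁‖ ^ (1 - (n : ℝ) / Q) :=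
      norm_limit_sub_limit_centre_le (A := fun r x => u t₂ (mollifierAt n r x))
        (v := fun x => v x t₂) hν.le hKM (happrox T M hT hM0 hM t₂ ⟨h₁.trans h₁₂, h₂⟩)
        (mollifierAt_bounds_of_ae hKgrad hu huQ hT hM0 hM t₂ ⟨h₁.trans h₁₂, h₂⟩).1 x₁ x₂
    have htime : ‖v x₁ t₂ - v x₁ t₁‖ ≤
        (2 * (K * M) + K) * (∫ t in t₁..t₂, f t) ^ (1 - (n : ℝ) / Q) :=
      norm_limit_sub_limit_le (A₁ := fun r => u t₁ (mollifierAt n r x₁))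
        (A₂ := fun r => u t₂ (mollifierAt n r x₁)) hν.le hK0 hδ
        (fun r hr => happrox T M hT hM0 hM t₁ ⟨h₁, h₁₂.trans h₂⟩ r hr x₁)
        (fun r hr => happrox T M hT hM0 hM t₂ ⟨h₁.trans h₁₂, h₂⟩ r hr x₁)
        fun r hr => norm_apply_sub_apply_le hu hut hf (by
          filter_upwards [hfut] with t ht
          exact (hKpair _ _ ht r hr x₁).trans_eq (by ring)) h₁ h₁₂
    have ha : 0 ≤ ‖x₂ - x₁‖ ^ (1 - (n : ℝ) / Q) := by positivity
    have hb : 0 ≤ (∫ t in t₁..t₂, f t) ^ (1 - (n : ℝ) / Q) := Real.rpow_nonneg hδ _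
    calc ‖v x₂ t₂ - v x₁ t₁‖ = ‖(v x₂ t₂ - v x₁ t₂) + (v x₁ t₂ - v x₁ t₁)‖ := by
          rw [sub_add_sub_cancel]
      _ ≤ _ := norm_add_le _ _
      _ ≤ _ := add_le_add hspace htime
      _ ≤ K * (3 * M + 1) * ‖x₂ - x₁‖ ^ (1 - (n : ℝ) / Q)
          + K * (3 * M + 1) * (∫ t in t₁..t₂, f t) ^ (1 - (n : ℝ) / Q) := by
          have h3 : 3 * (K * M) ≤ K * (3 * M + 1) := by linarith
          have h4 : 2 * (K * M) + K ≤ K * (3 * M + 1) := by linarith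
          exact add_le_add (mul_le_mul_of_nonneg_right h3 ha) (mul_le_mul_of_nonneg_right h4 hb)
      _ = _ := by ring
  have hcont : ∀ T, 0 < T → ContinuousOn
      (fun z : EuclideanSpace ℝ (Fin n) × ℝ => v z.1 z.2) (univ ×ˢ Icc 0 T) := by
    intro T hT
    obtain ⟨M, hM0, hM⟩ := hgradM T hT
    exact continuousOn_of_holder_estimate hα hf (hest T M hT hM0 hM)
  refine ⟨v, fun t ht => ?_, fun T hT => ⟨hcont T hT, fun M hM => ?_⟩⟩
  · have hT : 0 < t + 1 := by linarith
    obtain ⟨M, hM0, hM⟩ := hgradM (t + 1) hT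
    obtain ⟨c, hc0, hc⟩ := huQ.exists_ae_lpNormLE hT
    -- The sup bound compares `v` with its average at scale `1`, which is at most `K * c`; the
    -- difference is at most `K * M`.
    refine representedBy_of_ae hu hT (hcont _ hT) (D := K * c + K * M) (fun x s hs => ?_) ?_ t
      ⟨ht, by linarith⟩
    · have h1 := happrox (t + 1) M hT hM0 hM s hs 1 one_pos x
      have h2 : ‖u s (mollifierAt n 1 x)‖ ≤ K * c :=
        forall_mem_Icc_le_of_ae_le hT (hu.continuousOn_apply _ _).norm
          (hc.mono fun s hs => by simpa using hKpair _ _ hs 1 one_pos x) s hs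
      rw [Real.one_rpow, mul_one] at h1
      have := norm_sub_le (u s (mollifierAt n 1 x)) (u s (mollifierAt n 1 x) - v x s)
      rw [sub_sub_cancel] at this
      linarith
    · obtain ⟨g, hg, -⟩ := huQ
      filter_upwards [ae_restrict_of_ae_restrict_of_subset Icc_subset_Ici_self hg,
        ae_restrict_mem measurableSet_Icc] with s hs hs0 φ
      rw [← hs, Lp.toTemperedDistribution_apply]
      refine integral_congr_ae ?_
      -- The averages converge to `g s x` for almost every `x` and to `v x s` for every `x`.
      filter_upwards [ae_tendsto_mollifierAt (g s)] with x hx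
      rw [hs] at hx
      rw [tendsto_nhds_unique hx (hv s hs0.1 x)]
  · have hM0 : 0 ≤ M := by
      -- Since `[0,T]` has positive measure and `n ≥ 1`, some norm is bounded by `M`.
      have : (ae (volume.restrict (Icc 0 T))).NeBot := by
        rw [ae_neBot, Ne, Measure.restrict_eq_zero, Real.volume_Icc]
        simpa using hT
      obtain ⟨t, ht⟩ := hM.exists
      obtain ⟨g, -, hg⟩ := ht ⟨0, hn⟩
      exact (norm_nonneg g).trans hg
    intro x₁ x₂ t₁ t₂ _ h₁ h₁₂ h₂ _
    exact hest T M hT hM0 hM x₁ x₂ t₁ t₂ h₁ h₁₂ h₂
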